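/- \textbf{Strong divergence of the Monte Carlo Euler method.} Let $T\in(0,\infty)$, let $(\Omega,\mathcal F,\mathbb P)$ be a probability space with a normal filtration $(\mathcal F_t)_{t\in[0,T]}$ (that is, $\mathcal F_0$ contains all $A \in \mathcal F$ with $\mathbb P[A]=0$, and $\mathcal F_t=\bigcap_{s\in(t,T]}\mathcal F_s$ for $t\in[0,T)$), let $W^k\colon[0,T]\times\Omega\to\mathbb R$, $k\in\mathbb N=\{1,2,\dots\}$, be independent one-dimensional standard $(\mathcal F_t)_{t\in[0,T]}$-Brownian motions, and let $\xi^k\colon\Omega\to\mathbb R$, $k\in\mathbb N$, be independent identically distributed $\mathcal F_0$-measurable mappings with $\mathbb E[|\xi^1|^q]<\infty$ for all $q\in[1,\infty)$. Let $\mu,\sigma\colon\mathbb R\to\mathbb R$ be Borel measurable, and let $X\colon[0,T]\times\Omega\to\mathbb R$ be a predictable process with $\int_0^T |\mu(X_s)|+|\sigma(X_s)|^2\,ds<\infty$ $\mathbb P$-almost surely and, for every $t\in[0,T]$, $$X_t=\xi^1+\int_0^t\mu(X_s)\,ds+\int_0^t\sigma(X_s)\,dW^1_s\qquad \mathbb P\text{-almost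 surely}.$$ Define the Euler approximations $Y^{N,k}_n$, $n\in\{0,1,\dots,N\}$, $N,k\in\mathbb N$, by $Y^{N,k}_0:=\xi^k$ and $$Y^{N,k}_{n+1}:=Y^{N,k}_n+\mu(Y^{N,k}_n)\cdot\tfrac TN+\sigma(Y^{N,k}_n)\cdot\bigl(W^k_{(n+1)T/N}-W^k_{nT/N}\bigr),\qquad n\in\{0,1,\dots,N-1\}.$$ Let $\alpha,c\in(1,\infty)$ be such that $|\mu(x)|+|\sigma(x)|\ge |x|^\alpha/c$ for all $x\in\mathbb R$ with $|x|\ge c$. Assume that $\mathbb P[\sigma(\xi^1)\ne0]>0$, or that there is a $\beta\in(1,\infty)$ with $\mathbb P[|\xi^1|\ge x]\ge\beta^{(-x^\beta)}$ for all $x\in[1,\infty)$. Let $f\colon\mathbb R\to\mathbb R$ be Borel measurable with $f(x)\ge\frac1c|x|^{1/c}-c$ for all $x\in\mathbb R$, so that $\mathbb E[f(X_T)]\in(-\infty,\infty]$ is well defined. Then, for every $p\in[1,\infty)$, $$\lim_{N\to\infty}\mathbb E\!\left[\,\left|\,\mathbb E\bigl[f(X_T)\bigr]-\frac1{N^2}\sum_{k=1}^{N^2}f\bigl(Y^{N,k}_N\bigr)\right|^p\,\right]=\infty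 ,$$ where the quantity inside the outer expectation is $\infty$ if $\mathbb E[f(X_T)]=\infty$. -/

import Mathlib

open MeasureTheory ProbabilityTheory Filter Topology
open scoped ENNReal

noncomputable section

namespace MCEuler

variable {Ω : Type*} {mΩ : MeasurableSpace Ω} {T : ℝ}

/-- The time `0` as a point of the time interval `[0, T]`. -/
def startTime (hT : 0 < T) : Set.Icc (0 : ℝ) T := ⟨0, le_rfl, hT.le⟩

/-- The time `T` as a point of the time interval `[0, T]`. -/
def endTime (hT : 0 < T) : Set.Icc (0 : ℝ) T := ⟨T, hT.le, le_rfl⟩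

/-- The grid time `n T / N` as a point of `[0, T]`; the projection onto `[0, T]` does nothing
for `n ≤ N`, see `coe_gridTime`. -/
def gridTime (hT : 0 < T) (N n : ℕ) : Set.Icc (0 : ℝ) T :=
  Set.projIcc 0 T hT.le (n * T / N)

theorem coe_gridTime (hT : 0 < T) {N n : ℕ} (hN : 0 < N) (hn : n ≤ N) :
    (gridTime hT N n : ℝ) = n * T / N := by
  have hN' : (0 : ℝ) < N := by exact_mod_cast hN
  have hn' : (n : ℝ) ≤ N := by exact_mod_cast hn
  have h : (n * T / N : ℝ) ∈ Set.Icc (0 : ℝ) T := by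
    constructor
    · positivity
    · rw [div_le_iff₀ hN']
      nlinarith
  simp [gridTime, Set.projIcc_of_mem hT.le h]

/-- Lebesgue measure on `[0, T]`. -/
def timeMeasure (T : ℝ) : Measure (Set.Icc (0 : ℝ) T) :=
  Measure.comap Subtype.val volume

/-- A normal filtration on `[0, T]`: every null event belongs to all `𝓕 t` (equivalently to
`𝓕 0`), and `𝓕 t` is the intersection of the `𝓕 s`, `s > t`, for all `t < T`. -/
structure IsNormalFiltration (P : Measure Ω) (𝓕 : Filtration (Set.Icc (0 : ℝ) T) mΩ) :
    Prop where
  null_mem : ∀ (t : Set.Icc (0 : ℝ) T) (A : Set Ω),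
    MeasurableSet A → P A = 0 → MeasurableSet[𝓕 t] A
  right_continuous : ∀ t : Set.Icc (0 : ℝ) T, (t : ℝ) < T → ⨅ s > t, 𝓕 s = 𝓕 t

/-- One-dimensional standard Brownian motion on `[0, T]` with respect to the filtration `𝓕`. -/
structure IsStandardBrownianMotion (hT : 0 < T) (P : Measure Ω)
    (𝓕 : Filtration (Set.Icc (0 : ℝ) T) mΩ) (W : Set.Icc (0 : ℝ) T → Ω → ℝ) : Prop where
  adapted : ∀ t, Measurable[𝓕 t] (W t)
  start_zero : ∀ᵐ ω ∂P, W (startTime hT) ω = 0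
  indep_increments : ∀ s t, s ≤ t →
    Indep (MeasurableSpace.comap (fun ω => W t ω - W s ω) inferInstance) (𝓕 s) P
  gaussian_increments : ∀ s t, s ≤ t →
    HasLaw (fun ω => W t ω - W s ω) (gaussianReal 0 (Real.toNNReal ((t : ℝ) - s))) P
  continuous_paths : ∀ᵐ ω ∂P, Continuous fun t => W t ω

/-- Predictability of a real-valued process on `[0, T]`: measurability with respect to the
predictable σ-algebra of `𝓕`. -/
def IsPredictableProcess (hT : 0 < T) (𝓕 : Filtration (Set.Icc (0 : ℝ) T) mΩ)
    (X : Set.Icc (0 : ℝ) T → Ω → ℝ) : Prop :=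
  haveI : Fact ((0 : ℝ) ≤ T) := ⟨hT.le⟩
  IsStronglyPredictable 𝓕 X

/-- Simple predictable processes `∑ i < n, coeff i * 1_(times i, times (i + 1)]` with bounded
`𝓕 (times i)`-measurable coefficients. -/
structure SimpleProcess (𝓕 : Filtration (Set.Icc (0 : ℝ) T) mΩ) where
  n : ℕ
  times : ℕ → Set.Icc (0 : ℝ) T
  times_mono : Monotone times
  coeff : ℕ → Ω → ℝ
  coeff_measurable : ∀ i, Measurable[𝓕 (times i)] (coeff i)
  coeff_bounded : ∀ i, ∃ C : ℝ, ∀ ω, |coeff i ω| ≤ C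

/-- The value of a simple process at time `t`. -/
def SimpleProcess.value {𝓕 : Filtration (Set.Icc (0 : ℝ) T) mΩ} (S : SimpleProcess 𝓕)
    (t : Set.Icc (0 : ℝ) T) (ω : Ω) : ℝ :=
  ∑ i ∈ Finset.range S.n,
    (Set.Ioc (S.times i) (S.times (i + 1))).indicator (fun _ => S.coeff i ω) t

/-- The elementary stochastic integral `∫₀ᵗ S dW` of a simple process. -/
def SimpleProcess.integral {𝓕 : Filtration (Set.Icc (0 : ℝ) T) mΩ} (S : SimpleProcess 𝓕)
    (W : Set.Icc (0 : ℝ) T → Ω → ℝ) (t : Set.Icc (0 : ℝ) T) (ω : Ω) : ℝ :=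
  ∑ i ∈ Finset.range S.n,
    S.coeff i ω * (W (min t (S.times (i + 1))) ω - W (min t (S.times i)) ω)

/-- `J t` is (a version of) the Itô integral `∫₀ᵗ H dW` for all `t ∈ [0, T]`: there are simple
predictable processes `S m` with `∫₀ᵀ |H_s - (S m)_s|² ds → 0` in probability and
`∫₀ᵗ S m dW → J t` in probability. -/
def IsItoIntegral (P : Measure Ω) (𝓕 : Filtration (Set.Icc (0 : ℝ) T) mΩ)
    (W H J : Set.Icc (0 : ℝ) T → Ω → ℝ) : Prop :=
  ∃ S : ℕ → SimpleProcess 𝓕,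
    (∀ ε : ℝ≥0∞, 0 < ε → Tendsto
      (fun m => P {ω | ε ≤ ∫⁻ s,
        ENNReal.ofReal (|H s ω - (S m).value s ω| ^ 2) ∂timeMeasure T}) atTop (𝓝 0)) ∧
    ∀ t, TendstoInMeasure P (fun m => (S m).integral W t) atTop (J t)

/-- `X` is a predictable solution on `[0, T]` of
`X_t = ξ + ∫₀ᵗ μ(X_s) ds + ∫₀ᵗ σ(X_s) dW_s`. -/
structure IsSDESolution (hT : 0 < T) (P : Measure Ω)
    (𝓕 : Filtration (Set.Icc (0 : ℝ) T) mΩ) (W : Set.Icc (0 : ℝ) T → Ω → ℝ) (ξ : Ω → ℝ)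
    (μ σ : ℝ → ℝ) (X : Set.Icc (0 : ℝ) T → Ω → ℝ) : Prop where
  predictable : IsPredictableProcess hT 𝓕 X
  integrable : ∀ᵐ ω ∂P,
    (∫⁻ s, ENNReal.ofReal (|μ (X s ω)| + |σ (X s ω)| ^ 2) ∂timeMeasure T) < ∞
  equation : ∃ J : Set.Icc (0 : ℝ) T → Ω → ℝ,
    IsItoIntegral P 𝓕 W (fun s ω => σ (X s ω)) J ∧
    ∀ t, ∀ᵐ ω ∂P,
      X t ω = ξ ω + (∫ s in Set.Iic t, μ (X s ω) ∂timeMeasure T) + J t ω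

/-- The Euler approximations `Y_n^N`, `n ≤ N`, with `N` time steps, initial value `ξ` and
driving process `W`. -/
def euler (hT : 0 < T) (μ σ : ℝ → ℝ) (ξ : Ω → ℝ) (W : Set.Icc (0 : ℝ) T → Ω → ℝ) (N : ℕ) :
    ℕ → Ω → ℝ
  | 0 => ξ
  | n + 1 => fun ω =>
      euler hT μ σ ξ W N n ω
        + μ (euler hT μ σ ξ W N n ω) * (T / N)
        + σ (euler hT μ σ ξ W N n ω)
          * (W (gridTime hT N (n + 1)) ω - W (gridTime hT N n) ω)

/-- The expectation `E[Z] = E[Z⁺] - E[Z⁻]` as an extended real number; it is well defined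
whenever `E[Z⁺]` or `E[Z⁻]` is finite. -/
def extendedExpectation (P : Measure Ω) (Z : Ω → ℝ) : EReal :=
  ((∫⁻ ω, ENNReal.ofReal (Z ω) ∂P : ℝ≥0∞) : EReal)
    - ((∫⁻ ω, ENNReal.ofReal (-Z ω) ∂P : ℝ≥0∞) : EReal)

end MCEuler

end

/-! The averages diverge because of a rare but enormous event for one sample path. If |Y| is above a
threshold of order `N ^ s`, superlinear growth of the coefficients makes one Euler step raise |Y| to
the power γ = (α + 1) / 2 > 1, with conditional probability at least a constant q
(`rpow_le_abs_euler_step`, `measure_inter_euler_succ`). Iterating gives a value doubly exponential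
in N with probability at least q ^ N times that of reaching the threshold
(`measure_euler_explosion`); the latter is at least exp(-N ^ m) by
`exists_measure_euler_initial_ge`.

Neither the root 1 / c in the growth of `f`, nor division by N², nor the bounded-below contribution
of the other samples can offset this (`sub_le_average`), and a doubly exponential value outweighs an
exponential-of-polynomial rarity (`eventually_exp_pow_le`). The target expectation is a constant: if
it is infinite the claim is immediate, otherwise it is a finite shift. -/

namespace MCEuler

/-! ### Gaussian tails and random affine maps -/

/-- If `D` is symmetric and independent of `m`, then conditionally on `m` the event
`|a| + |b| d ≤ |a + b D|` has probability at least `P (d ≤ D)`. -/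
theorem measure_mul_le_measure_inter_abs_affine {Ω : Type*} {mΩ : MeasurableSpace Ω}
    {P : Measure Ω} {m : MeasurableSpace Ω} (hm : m ≤ mΩ) {D : Ω → ℝ} {v : NNReal}
    (hD : HasLaw D (gaussianReal 0 v) P)
    (hind : Indep (MeasurableSpace.comap D inferInstance) m P)
    {a b : Ω → ℝ} (ha : Measurable[m] a) (hb : Measurable[m] b) {A : Set Ω}
    (hA : MeasurableSet[m] A) {d : ℝ} (hd : 0 ≤ d) :
    gaussianReal 0 v (Set.Ici d) * P A ≤
      P (A ∩ {ω | |a ω| + |b ω| * d ≤ |a ω + b ω * D ω|}) := by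
  -- Split by the sign of `a * b`, which `m` knows: use `d ≤ D` where it is nonnegative and `D ≤ -d`
  -- elsewhere. Then `b * D` never opposes `a`, so absolute values add, and by symmetry both tails
  -- have the same mass.
  have hS : MeasurableSet[m] {ω | 0 ≤ a ω * b ω} := by
    exact measurableSet_le measurable_const (ha.mul hb)
  have h1 : P (D ⁻¹' Set.Ici d) = gaussianReal 0 v (Set.Ici d) := by
    rw [← hD.map_eq, Measure.map_apply_of_aemeasurable hD.aemeasurable measurableSet_Ici]
  have h2 : P (D ⁻¹' Set.Iic (-d)) = gaussianReal 0 v (Set.Ici d) := by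
    rw [← Measure.map_apply_of_aemeasurable hD.aemeasurable measurableSet_Iic, hD.map_eq]
    have h := gaussianReal_map_neg (μ := 0) (v := v)
    rw [neg_zero] at h
    conv_lhs => rw [← h]
    rw [Measure.map_apply measurable_neg measurableSet_Iic]
    congr 1
    ext x
    simp
  have hi1 := (Indep_iff _ _ _).1 hind (D ⁻¹' Set.Ici d) (A ∩ {ω | 0 ≤ a ω * b ω})
    ⟨_, measurableSet_Ici, rfl⟩ (hA.inter hS)
  have hi2 := (Indep_iff _ _ _).1 hind (D ⁻¹' Set.Iic (-d)) (A \ {ω | 0 ≤ a ω * b ω})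
    ⟨_, measurableSet_Iic, rfl⟩ (hA.diff hS)
  rw [← measure_inter_add_sdiff A (hm _ hS), mul_add]
  nth_rewrite 1 [← h1]
  rw [← h2, ← hi1, ← hi2,
    ← measure_inter_add_sdiff (A ∩ {ω | |a ω| + |b ω| * d ≤ |a ω + b ω * D ω|}) (hm _ hS)]
  refine add_le_add (measure_mono ?_) (measure_mono ?_)
  · rintro ω ⟨hDω, hAω, hab⟩
    simp only [Set.mem_preimage, Set.mem_Ici, Set.mem_ofPred_eq] at hDω hab
    refine ⟨⟨hAω, ?_⟩, hab⟩
    have h0 : 0 ≤ a ω * (b ω * D ω) := by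
      rw [← mul_assoc]; exact mul_nonneg hab (hd.trans hDω)
    simp only [Set.mem_ofPred_eq]
    rw [(abs_add_eq_add_abs_iff _ _).2 (mul_nonneg_iff.1 h0), abs_mul]
    gcongr
    exact hDω.trans (le_abs_self _)
  · rintro ω ⟨hDω, hAω, hab⟩
    simp only [Set.mem_preimage, Set.mem_Iic, Set.mem_ofPred_eq, not_le] at hDω hab
    refine ⟨⟨hAω, ?_⟩, not_le.2 hab⟩
    have h0 : 0 ≤ a ω * (b ω * D ω) := by
      rw [← mul_assoc]; exact mul_nonneg_of_nonpos_of_nonpos hab.le (by linarith)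
    simp only [Set.mem_ofPred_eq]
    rw [(abs_add_eq_add_abs_iff _ _).2 (mul_nonneg_iff.1 h0), abs_mul]
    gcongr
    exact (le_neg_of_le_neg hDω).trans (neg_le_abs _)

/-- The tail contains an interval one standard deviation long, on which the density is at least its
value at the right endpoint; the factors √v cancel. -/
theorem exp_le_gaussianReal_Ici {v : NNReal} (hv : 0 < v) {u : ℝ} (hu : 0 ≤ u) :
    ENNReal.ofReal ((√(2 * Real.pi))⁻¹ * Real.exp (-(u + 1) ^ 2 / 2)) ≤
      gaussianReal 0 v (Set.Ici (u * √v)) := by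
  have hv' : (0 : ℝ) < v := by exact_mod_cast hv
  have hs : 0 < √(v : ℝ) := Real.sqrt_pos.2 hv'
  calc ENNReal.ofReal ((√(2 * Real.pi))⁻¹ * Real.exp (-(u + 1) ^ 2 / 2))
      = ENNReal.ofReal ((√(2 * Real.pi * v))⁻¹ * Real.exp (-(u + 1) ^ 2 / 2))
          * volume (Set.Icc (u * √v) ((u + 1) * √v)) := by
        rw [Real.volume_Icc, ← ENNReal.ofReal_mul (by positivity),
          Real.sqrt_mul (by positivity) (v : ℝ)]
        congr 1
        field_simp
        ring
    _ ≤ ∫⁻ x in Set.Icc (u * √v) ((u + 1) * √v), gaussianPDF 0 v x := by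
        rw [← setLIntegral_const]
        refine setLIntegral_mono (measurable_gaussianPDF 0 v) fun x hx => ?_
        rw [gaussianPDF, gaussianPDFReal]
        refine ENNReal.ofReal_le_ofReal ?_
        gcongr ?_ * Real.exp ?_
        have hx0 : 0 ≤ x := le_trans (by positivity) hx.1
        have hx2 : x ^ 2 ≤ (u + 1) ^ 2 * v := by
          calc x ^ 2 ≤ ((u + 1) * √v) ^ 2 := by gcongr; exact hx.2
            _ = _ := by rw [mul_pow, Real.sq_sqrt hv'.le]
        rw [sub_zero, neg_div, neg_div, neg_le_neg_iff, div_le_div_iff₀ (by positivity) two_pos]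
        linarith
    _ ≤ ∫⁻ x in Set.Ici (u * √v), gaussianPDF 0 v x :=
        lintegral_mono_set Set.Icc_subset_Ici_self
    _ = gaussianReal 0 v (Set.Ici (u * √v)) := (gaussianReal_apply 0 hv.ne' _).symm

/-! ### Measurability and one step of the Euler scheme -/

theorem gridTime_mono {T : ℝ} (hT : 0 < T) (N : ℕ) : Monotone (gridTime hT N) := by
  intro i j hij
  refine Set.monotone_projIcc hT.le ?_
  gcongr

theorem gridTime_zero {T : ℝ} (hT : 0 < T) (N : ℕ) : gridTime hT N 0 = startTime hT := by
  simp [gridTime, startTime, Set.projIcc_left]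

theorem coe_gridTime_succ_sub {T : ℝ} (hT : 0 < T) {N n : ℕ} (hn : n < N) :
    (gridTime hT N (n + 1) : ℝ) - gridTime hT N n = T / N := by
  rw [coe_gridTime hT (by lia) (by lia), coe_gridTime hT (by lia) hn.le]
  push_cast
  ring

section

variable {Ω : Type*} {mΩ : MeasurableSpace Ω} {P : Measure Ω} {T : ℝ} {hT : 0 < T}
  {𝓕 : Filtration (Set.Icc (0 : ℝ) T) mΩ} {W : Set.Icc (0 : ℝ) T → Ω → ℝ} {ξ : Ω → ℝ}
  {μ σ : ℝ → ℝ}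

theorem measurable_euler (hW : IsStandardBrownianMotion hT P 𝓕 W)
    (hξ : Measurable[𝓕 (startTime hT)] ξ) (hμ : Measurable μ) (hσ : Measurable σ) (N n : ℕ) :
    Measurable[𝓕 (gridTime hT N n)] (euler hT μ σ ξ W N n) := by
  induction n with
  | zero => rw [gridTime_zero]; exact hξ
  | succ n ih =>
    have hle := 𝓕.mono (gridTime_mono hT N n.le_succ)
    have hY : Measurable[𝓕 (gridTime hT N (n + 1))] (euler hT μ σ ξ W N n) := ih.mono hle le_rfl
    have hd : Measurable[𝓕 (gridTime hT N (n + 1))]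
        (fun ω => W (gridTime hT N (n + 1)) ω - W (gridTime hT N n) ω) :=
      (hW.adapted _).sub ((hW.adapted _).mono hle le_rfl)
    exact (hY.add ((hμ.comp hY).mul_const _)).add ((hσ.comp hY).mul hd)

/-- One step of the Euler scheme, started on the event `A`, exceeds
`|y + μ y * T / N| + |σ y| * u * √(T / N)` with at least the probability of a Gaussian tail. -/
theorem measure_inter_euler_succ (hW : IsStandardBrownianMotion hT P 𝓕 W)
    (hξ : Measurable[𝓕 (startTime hT)] ξ) (hμ : Measurable μ) (hσ : Measurable σ) {N n : ℕ}
    (hn : n < N) {A : Set Ω} (hA : MeasurableSet[𝓕 (gridTime hT N n)] A) {u : ℝ} (hu : 0 ≤ u) :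
    ENNReal.ofReal ((√(2 * Real.pi))⁻¹ * Real.exp (-(u + 1) ^ 2 / 2)) * P A ≤
      P (A ∩ {ω | |euler hT μ σ ξ W N n ω + μ (euler hT μ σ ξ W N n ω) * (T / N)|
        + |σ (euler hT μ σ ξ W N n ω)| * (u * √(T / N)) ≤ |euler hT μ σ ξ W N (n + 1) ω|}) := by
  have hY := measurable_euler hW hξ hμ hσ N n
  have hle := gridTime_mono hT N n.le_succ
  have hN : (0 : ℝ) < N := by exact_mod_cast (by lia : 0 < N)
  have hh : 0 < T / N := by positivity
  have hlaw := hW.gaussian_increments _ _ hle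
  rw [coe_gridTime_succ_sub hT hn] at hlaw
  have h := measure_mul_le_measure_inter_abs_affine (𝓕.le _) hlaw
    (hW.indep_increments _ _ hle) (hY.add ((hμ.comp hY).mul_const (T / N))) (hσ.comp hY) hA
    (d := u * √(T / N)) (by positivity)
  have hg := exp_le_gaussianReal_Ici (v := (T / N).toNNReal) (by simpa using hh) hu
  rw [Real.coe_toNNReal _ hh.le] at hg
  exact (mul_le_mul_left hg _).trans h

end

/-! ### Doubly exponential explosion -/

/-- Superlinear growth of the coefficients turns into superlinear growth of the Euler step. -/
theorem rpow_le_abs_euler_step {μ σ : ℝ → ℝ} {α c h x : ℝ} (hc : 1 < c) (hh : 0 < h)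
    (hh1 : h ≤ 1) (hx1 : 1 ≤ |x|) (hgrowth : |x| ^ α / c ≤ |μ x| + |σ x|)
    (hα : 1 < α) (hx : 2 * c / h ≤ |x| ^ ((α - 1) / 2)) :
    |x| ^ ((α + 1) / 2) ≤ |x + μ x * h| + |σ x| * √h := by
  have hx0 : 0 < |x| := by linarith
  set z := |x| ^ ((α - 1) / 2) with hz
  have hz1 : 1 ≤ z := Real.one_le_rpow hx1 (by linarith)
  have e1 : |x| ^ ((α + 1) / 2) = |x| * z := by
    rw [hz, ← Real.rpow_one_add' hx0.le (by linarith)]; congr 1; ring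
  -- One factor `z` pays for `2 * c / h`, leaving a gain of `2 * |x| * z`; half of it absorbs the
  -- `|x|` lost to cancellation in `x + μ x * h`.
  have e2 : |x| ^ α = |x| * z * z := by
    rw [← e1, hz, ← Real.rpow_add hx0]; congr 1; ring
  have hs : h ≤ √h := Real.le_sqrt_of_sq_le (by nlinarith)
  have h1 : |μ x| * h - |x| ≤ |x + μ x * h| := by
    have := abs_sub_abs_le_abs_sub (μ x * h) (-x)
    rw [abs_neg, abs_mul, abs_of_pos hh, sub_neg_eq_add, add_comm (μ x * h)] at this
    exact this
  have h2 : |σ x| * h ≤ |σ x| * √h := by gcongr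
  have h3 : |x| * z * 2 ≤ |x| ^ α / c * h := by
    rw [e2, div_mul_eq_mul_div, le_div_iff₀ (by linarith), mul_assoc, mul_assoc (|x| * z)]
    rw [div_le_iff₀ hh] at hx
    gcongr
  have h4 : |x| ^ α / c * h ≤ (|μ x| + |σ x|) * h := by gcongr
  rw [e1]
  nlinarith [mul_le_mul_of_nonneg_left hz1 hx0.le]

section

variable {Ω : Type*} {mΩ : MeasurableSpace Ω} {P : Measure Ω} {T : ℝ} {hT : 0 < T}
  {𝓕 : Filtration (Set.Icc (0 : ℝ) T) mΩ} {W : Set.Icc (0 : ℝ) T → Ω → ℝ} {ξ : Ω → ℝ}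
  {μ σ : ℝ → ℝ}

/-- Once the Euler scheme has left a sufficiently large interval, it explodes doubly
exponentially with at least exponentially small probability. -/
theorem measure_euler_explosion (hW : IsStandardBrownianMotion hT P 𝓕 W)
    (hξ : Measurable[𝓕 (startTime hT)] ξ) (hμ : Measurable μ) (hσ : Measurable σ)
    {α c K : ℝ} (hα : 1 < α) (hc : 1 < c)
    (hgrowth : ∀ x : ℝ, c ≤ |x| → |x| ^ α / c ≤ |μ x| + |σ x|) {N : ℕ} (hTN : T ≤ N)
    (hcK : c ≤ K) (hK : 2 * c / (T / N) ≤ K ^ ((α - 1) / 2)) (n₀ k : ℕ) (hk : n₀ + k ≤ N) :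
    ENNReal.ofReal ((√(2 * Real.pi))⁻¹ * Real.exp (-2)) ^ k
        * P {ω | K ≤ |euler hT μ σ ξ W N n₀ ω|} ≤
      P {ω | K ^ (((α + 1) / 2) ^ k) ≤ |euler hT μ σ ξ W N (n₀ + k) ω|} := by
  have hN : (0 : ℝ) < N := hT.trans_le hTN
  have hK0 : 0 ≤ K := by linarith
  have hK1 : 1 ≤ K := by linarith
  induction k with
  | zero => simp
  | succ k ih =>
    have hY := measurable_euler hW hξ hμ hσ N (n₀ + k)
    have hA : MeasurableSet[𝓕 (gridTime hT N (n₀ + k))]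
        {ω | K ^ (((α + 1) / 2) ^ k) ≤ |euler hT μ σ ξ W N (n₀ + k) ω|} :=
      hY (measurableSet_le measurable_const continuous_abs.measurable :
        MeasurableSet {x : ℝ | K ^ (((α + 1) / 2) ^ k) ≤ |x|})
    -- Taking `u = 1`, one standard deviation of the increment, makes the success probability
    -- independent of `N`.
    have hstep := measure_inter_euler_succ hW hξ hμ hσ (by lia : n₀ + k < N) hA zero_le_one
    rw [show -(1 + 1 : ℝ) ^ 2 / 2 = -2 by norm_num, one_mul] at hstep
    rw [pow_succ', mul_assoc]
    refine (mul_le_mul_right (ih (by lia)) _).trans ?_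
    refine (hstep).trans (measure_mono ?_)
    rintro ω ⟨h1, h2⟩
    simp only [Set.mem_ofPred_eq] at h1 h2 ⊢
    have hKk : K ≤ K ^ (((α + 1) / 2) ^ k) :=
      Real.self_le_rpow_of_one_le hK1 (one_le_pow₀ (by linarith))
    have hKy := hKk.trans h1
    refine le_trans ?_ ((rpow_le_abs_euler_step hc (by positivity) ((div_le_one hN).2 hTN)
      (hK1.trans hKy) (hgrowth _ (hcK.trans hKy)) hα (hK.trans ?_)).trans h2)
    · rw [pow_succ, Real.rpow_mul hK0]
      gcongr
    · gcongr

end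

/-! ### Comparison of growth rates -/

theorem eventually_le_natCast (C : ℝ) : ∀ᶠ N : ℕ in atTop, C ≤ N :=
  tendsto_natCast_atTop_atTop.eventually_ge_atTop C

/-- A doubly exponential value beats an exponential of a polynomial. -/
theorem eventually_exp_pow_le {γ c a C : ℝ} (hγ : 1 < γ) (hc : 1 < c) (ha : 0 ≤ a) (hC : 0 ≤ C)
    (m : ℕ) :
    ∀ᶠ N : ℕ in atTop, Real.exp ((N : ℝ) ^ m + a * N) * N ≤
      Real.exp (γ ^ (N - 1) / c) / (c * (N : ℝ) ^ 2) - C := by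
  -- The extra `5 * N` in the exponent pays for `N ^ 5`, which bounds the polynomial factor `(N + C)
  -- * (c * N ^ 2)`.
  have hlim : Tendsto (fun N : ℕ => (N : ℝ) ^ m / γ ^ N + (a + 5) * ((N : ℝ) ^ 1 / γ ^ N))
      atTop (𝓝 0) := by
    simpa using (tendsto_pow_const_div_const_pow_of_one_lt m hγ).add
      ((tendsto_pow_const_div_const_pow_of_one_lt 1 hγ).const_mul (a + 5))
  have hpos : 0 < 1 / (γ * c) := by positivity
  filter_upwards [hlim.eventually_le_const hpos, eventually_le_natCast c,
    eventually_le_natCast C, eventually_le_natCast 2, eventually_ge_atTop 1]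
    with N h1 hNc hNC hN2 hN1
  have hN0 : (0 : ℝ) < N := by linarith
  have hγN : γ ^ N = γ ^ (N - 1) * γ := by rw [← pow_succ, Nat.sub_add_cancel hN1]
  have h2 : (N : ℝ) ^ m + a * N + 5 * N ≤ γ ^ (N - 1) / c := by
    have h4 : (N : ℝ) ^ m / γ ^ N + (a + 5) * ((N : ℝ) ^ 1 / γ ^ N)
        = ((N : ℝ) ^ m + a * N + 5 * N) / γ ^ N := by ring
    rw [h4, div_le_iff₀ (by positivity), hγN] at h1
    refine h1.trans (le_of_eq ?_)
    field_simp
  have h5 : (N : ℝ) ^ 5 ≤ Real.exp (5 * N) := by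
    have h6 : (N : ℝ) ≤ Real.exp N := by linarith [Real.add_one_le_exp (N : ℝ)]
    calc (N : ℝ) ^ 5 ≤ Real.exp N ^ 5 := by gcongr
      _ = _ := by rw [← Real.exp_nat_mul]; norm_num
  have h7 := Real.exp_le_exp.2 h2
  rw [Real.exp_add] at h7
  set E := Real.exp ((N : ℝ) ^ m + a * N) with hE
  have hE0 : 0 < E := Real.exp_pos _
  have hE1 : E * (N + C) * (c * (N : ℝ) ^ 2) ≤ E * (N : ℝ) ^ 5 := by
    rw [mul_assoc]
    gcongr
    calc (N + C) * (c * (N : ℝ) ^ 2) ≤ (N * N) * (N * (N : ℝ) ^ 2) := by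
          gcongr
          nlinarith
      _ = _ := by ring
  have hE2 : E * N + C ≤ E * (N + C) := by
    have : 1 ≤ E := Real.one_le_exp (by positivity)
    nlinarith
  rw [le_sub_iff_add_le, le_div_iff₀ (by positivity)]
  calc (E * N + C) * (c * (N : ℝ) ^ 2) ≤ E * (N + C) * (c * (N : ℝ) ^ 2) := by gcongr
    _ ≤ E * (N : ℝ) ^ 5 := hE1
    _ ≤ E * Real.exp (5 * N) := by gcongr
    _ ≤ _ := h7

/-! ### Reaching the threshold -/

/-- The polynomially growing threshold `N ^ s` is exceeded after at most one Euler step with a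
probability that is at least the exponential of a negative polynomial. -/
theorem exists_measure_euler_initial_ge {Ω : Type*} {mΩ : MeasurableSpace Ω} {P : Measure Ω}
    [IsProbabilityMeasure P] {T : ℝ} {hT : 0 < T}
    {𝓕 : Filtration (Set.Icc (0 : ℝ) T) mΩ} {W : Set.Icc (0 : ℝ) T → Ω → ℝ} {ξ : Ω → ℝ}
    {μ σ : ℝ → ℝ} (hW : IsStandardBrownianMotion hT P 𝓕 W)
    (hξ : Measurable[𝓕 (startTime hT)] ξ) (hμ : Measurable μ) (hσ : Measurable σ)
    (hnoise : 0 < P {ω | σ (ξ ω) ≠ 0} ∨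
      ∃ β : ℝ, 1 < β ∧ ∀ x : ℝ, 1 ≤ x → β ^ (-(x ^ β)) ≤ P.real {ω | x ≤ |ξ ω|}) (s : ℕ) :
    ∃ n₀ ≤ 1, ∃ m : ℕ, ∀ᶠ N : ℕ in atTop, ENNReal.ofReal (Real.exp (-(N : ℝ) ^ m)) ≤
      P {ω | (N : ℝ) ^ s ≤ |euler hT μ σ ξ W N n₀ ω|} := by
  rcases hnoise with hnoise | ⟨β, hβ, htail⟩
  · have hδ : ∃ δ : ℝ, 0 < δ ∧ 0 < P {ω | δ ≤ |σ (ξ ω)|} := by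
      by_contra! hcon
      refine hnoise.ne' (measure_mono_null (t := ⋃ n : ℕ, {ω | 1 / ((n : ℝ) + 1) ≤ |σ (ξ ω)|})
        (fun ω hω => ?_) (measure_iUnion_null fun n => ?_))
      · obtain ⟨n, hn⟩ := exists_nat_one_div_lt (abs_pos.2 hω)
        exact Set.mem_iUnion.2 ⟨n, hn.le⟩
      · exact nonpos_iff_eq_zero.1 (hcon _ (by positivity))
    obtain ⟨δ, hδ, hρ⟩ := hδ
    -- The Gaussian exponent is at most `2 * N ^ (2 * s + 4)`, since `u ≤ N ^ (s + 2)`; the two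
    -- further powers absorb the factor 2 and `-log κ`.
    refine ⟨1, le_rfl, 2 * s + 6, ?_⟩
    set A := {ω | δ ≤ |σ (ξ ω)|} with hA
    have hρ' : 0 < P.real A := ENNReal.toReal_pos hρ.ne' (measure_ne_top _ _)
    set κ := (√(2 * Real.pi))⁻¹ * P.real A with hκ
    have hκ0 : 0 < κ := by positivity
    filter_upwards [eventually_le_natCast (1 / (δ * √T)), eventually_le_natCast (-Real.log κ),
      eventually_le_natCast 2, eventually_ge_atTop 1] with N hNδ hNκ hN2 hN1
    have hN0 : (0 : ℝ) < N := by linarith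
    have hTs : 0 < √T := Real.sqrt_pos.2 hT
    -- Chosen so that `δ * (u * √(T / N)) = N ^ s`: the noise alone reaches the threshold.
    set u : ℝ := (N : ℝ) ^ s * (√N * (1 / (δ * √T))) with hu
    have hu0 : 0 ≤ u := by positivity
    have hmeas : MeasurableSet[𝓕 (gridTime hT N 0)] A := by
      rw [gridTime_zero]
      exact (hσ.comp hξ) (measurableSet_le measurable_const continuous_abs.measurable :
        MeasurableSet {x : ℝ | δ ≤ |x|})
    refine le_trans ?_ ((measure_inter_euler_succ hW hξ hμ hσ (by lia : 0 < N) hmeas hu0).trans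
      (measure_mono ?_))
    · rw [← ofReal_measureReal, ← ENNReal.ofReal_mul (by positivity)]
      refine ENNReal.ofReal_le_ofReal ?_
      have hu1 : u ≤ (N : ℝ) ^ (s + 2) := by
        have hsq : √(N : ℝ) ≤ N := Real.sqrt_le_iff.2 ⟨hN0.le, by nlinarith⟩
        calc u ≤ (N : ℝ) ^ s * (N * N) := by rw [hu]; gcongr
          _ = _ := by ring
      have hone : (1 : ℝ) ≤ (N : ℝ) ^ (s + 2) := one_le_pow₀ (by linarith)
      have hu2 : (u + 1) ^ 2 / 2 ≤ 2 * (N : ℝ) ^ (2 * s + 4) := by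
        have : (u + 1) ^ 2 ≤ (2 * (N : ℝ) ^ (s + 2)) ^ 2 := by gcongr; linarith
        have e : (2 * (N : ℝ) ^ (s + 2)) ^ 2 = 4 * (N : ℝ) ^ (2 * s + 4) := by ring
        linarith
      have hpow : 2 * (N : ℝ) ^ (2 * s + 4) + N ≤ (N : ℝ) ^ (2 * s + 6) := by
        have h1 : (N : ℝ) ≤ (N : ℝ) ^ (2 * s + 4) := le_self_pow₀ (by linarith) (by lia)
        have h2 : (N : ℝ) ^ (2 * s + 6) = (N : ℝ) ^ (2 * s + 4) * (N * N) := by ring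
        have h3 : (4 : ℝ) ≤ N * N := by nlinarith
        rw [h2]
        nlinarith [mul_le_mul_of_nonneg_left h3 (by positivity : 0 ≤ (N : ℝ) ^ (2 * s + 4))]
      calc Real.exp (-(N : ℝ) ^ (2 * s + 6))
          ≤ Real.exp (Real.log κ + -(u + 1) ^ 2 / 2) := by
            gcongr
            rw [neg_div]
            linarith
        _ = _ := by rw [Real.exp_add, Real.exp_log hκ0, hκ]; ring
    · rintro ω ⟨h1, h2⟩
      simp only [Set.mem_ofPred_eq, hA] at h1 h2 ⊢
      refine le_trans ?_ h2
      have e : (N : ℝ) ^ s = δ * (u * √(T / N)) := by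
        rw [hu, Real.sqrt_div hT.le]
        field_simp
      have : δ * (u * √(T / N)) ≤ |σ (euler hT μ σ ξ W N 0 ω)| * (u * √(T / N)) := by
        gcongr
        exact h1
      rw [e]
      exact this.trans (le_add_of_nonneg_left (abs_nonneg _))
  -- The initial value itself has heavy enough tails; the extra power of `N` absorbs `log β`.
  · refine ⟨0, zero_le_one, ⌈s * β⌉₊ + 1, ?_⟩
    filter_upwards [eventually_le_natCast (Real.log β), eventually_ge_atTop 1] with N hN hN1
    have hN1' : (1 : ℝ) ≤ N := by exact_mod_cast hN1
    have h := htail ((N : ℝ) ^ s) (one_le_pow₀ hN1')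
    rw [← ofReal_measureReal]
    refine ENNReal.ofReal_le_ofReal (le_trans ?_ h)
    rw [Real.rpow_def_of_pos (by linarith)]
    gcongr
    rw [mul_neg, neg_le_neg_iff, pow_succ, mul_comm]
    have hlog := Real.log_nonneg hβ.le
    gcongr
    rw [← Real.rpow_natCast_mul (by linarith), ← Real.rpow_natCast]
    exact Real.rpow_le_rpow_of_exponent_le hN1' (Nat.le_ceil _)

/-! ### Sample averages and the extended expectation -/

/-- A single huge sample cannot be cancelled by the others, as each contributes at least `-c`. -/
theorem sub_le_average {f : ℝ → ℝ} {c : ℝ} {g : ℝ → ℝ} (hg : ∀ x, 0 ≤ g x)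
    (hf : ∀ x, g x - c ≤ f x) {M : ℕ} (hM : 0 < M) (y : ℕ → ℝ) :
    g (y 0) / M - c ≤ 1 / (M : ℝ) * ∑ k ∈ Finset.range M, f (y k) := by
  have hM' : (0 : ℝ) < M := by exact_mod_cast hM
  have h1 : g (y 0) ≤ ∑ k ∈ Finset.range M, g (y k) :=
    Finset.single_le_sum (f := fun k => g (y k)) (fun k _ => hg _) (Finset.mem_range.2 hM)
  have h2 : ∑ k ∈ Finset.range M, (g (y k) - c) ≤ ∑ k ∈ Finset.range M, f (y k) :=
    Finset.sum_le_sum fun k _ => hf _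
  rw [Finset.sum_sub_distrib, Finset.sum_const, Finset.card_range, nsmul_eq_mul] at h2
  rw [one_div, ← div_eq_inv_mul, le_div_iff₀ hM', sub_mul, div_mul_cancel₀ _ hM'.ne']
  linarith

/-- The negative part has expectation at most `ENNReal.ofReal c`, so ∞ - ∞ cannot occur. -/
theorem extendedExpectation_eq_top_or_coe {Ω : Type*} {mΩ : MeasurableSpace Ω} (P : Measure Ω)
    [IsProbabilityMeasure P] {Z : Ω → ℝ} {c : ℝ} (hZ : ∀ ω, -c ≤ Z ω) :
    extendedExpectation P Z = ⊤ ∨ ∃ e : ℝ, extendedExpectation P Z = e := by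
  have hneg : ∫⁻ ω, ENNReal.ofReal (-Z ω) ∂P ≠ ∞ := by
    refine ne_top_of_le_ne_top (b := ENNReal.ofReal c) ENNReal.ofReal_ne_top ?_
    calc ∫⁻ ω, ENNReal.ofReal (-Z ω) ∂P ≤ ∫⁻ _, ENNReal.ofReal c ∂P :=
          lintegral_mono fun ω => ENNReal.ofReal_le_ofReal (by linarith [hZ ω])
      _ = ENNReal.ofReal c := by simp
  unfold extendedExpectation
  lift ∫⁻ ω, ENNReal.ofReal (-Z ω) ∂P to NNReal using hneg with b
  rcases eq_or_ne (∫⁻ ω, ENNReal.ofReal (Z ω) ∂P) ∞ with h | h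
  · left
    rw [h]
    exact EReal.top_sub_coe _
  · right
    lift ∫⁻ ω, ENNReal.ofReal (Z ω) ∂P to NNReal using h with a
    exact ⟨a - b, rfl⟩

end MCEuler

/-! ### The divergence theorem -/

/-- The index `k : ℕ` of the sample paths starts at `0`: `W k` and `ξ k` are the `(k + 1)`-st
Brownian motion and the `(k + 1)`-st initial value. -/
theorem mainTheorem6 {Ω : Type*} {mΩ : MeasurableSpace Ω} (P : Measure Ω)
    [IsProbabilityMeasure P] (T : ℝ) (hT : 0 < T)
    (𝓕 : Filtration (Set.Icc (0 : ℝ) T) mΩ) (h𝓕 : MCEuler.IsNormalFiltration P 𝓕)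
    (W : ℕ → Set.Icc (0 : ℝ) T → Ω → ℝ)
    (hW : ∀ k, MCEuler.IsStandardBrownianMotion hT P 𝓕 (W k))
    (hW_indep : iIndepFun (fun k ω t => W k t ω) P)
    (ξ : ℕ → Ω → ℝ)
    (hξ_meas : ∀ k, Measurable[𝓕 (MCEuler.startTime hT)] (ξ k))
    (hξ_indep : iIndepFun ξ P)
    (hξ_ident : ∀ k, IdentDistrib (ξ k) (ξ 0) P P)
    (hξ_moments : ∀ p : ℝ, 1 ≤ p → Integrable (fun ω => |ξ 0 ω| ^ p) P)
    (μ σ : ℝ → ℝ) (hμ : Measurable μ) (hσ : Measurable σ)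
    (X : Set.Icc (0 : ℝ) T → Ω → ℝ)
    (hX : MCEuler.IsSDESolution hT P 𝓕 (W 0) (ξ 0) μ σ X)
    (α c : ℝ) (hα : 1 < α) (hc : 1 < c)
    (hgrowth : ∀ x : ℝ, c ≤ |x| → |x| ^ α / c ≤ |μ x| + |σ x|)
    (hnoise : 0 < P {ω | σ (ξ 0 ω) ≠ 0} ∨
      ∃ β : ℝ, 1 < β ∧ ∀ x : ℝ, 1 ≤ x → β ^ (-(x ^ β)) ≤ P.real {ω | x ≤ |ξ 0 ω|})
    (f : ℝ → ℝ) (hf : Measurable f)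
    (hf_growth : ∀ x : ℝ, 1 / c * |x| ^ (1 / c) - c ≤ f x)
    (p : ℝ) (hp : 1 ≤ p) :
    Tendsto
      (fun N : ℕ => ∫⁻ ω,
        (MCEuler.extendedExpectation P (fun ω' => f (X (MCEuler.endTime hT) ω'))
          - ((1 / (N : ℝ) ^ 2 *
              ∑ k ∈ Finset.range (N ^ 2), f (MCEuler.euler hT μ σ (ξ k) (W k) N N ω) : ℝ)
                : EReal)).abs ^ p ∂P)
      atTop (𝓝 ∞) := by
  have hfc : ∀ x, -c ≤ f x := fun x => by
    have : 0 ≤ 1 / c * |x| ^ (1 / c) := by positivity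
    linarith [hf_growth x]
  rcases MCEuler.extendedExpectation_eq_top_or_coe P
    (fun ω' => hfc (X (MCEuler.endTime hT) ω')) with hE | ⟨e, hE⟩
  · simp only [hE, EReal.top_sub_coe, EReal.abs_top, ENNReal.top_rpow_of_pos (by linarith : 0 < p),
      lintegral_const, measure_univ, mul_one]
    exact tendsto_const_nhds
  simp only [hE, ← EReal.coe_sub, EReal.abs_def]
  -- Makes `s * ((α - 1) / 2) ≥ 2`, so the threshold `N ^ s` raised to `(α - 1) / 2` dominates `2 *
  -- c / (T / N)`, which is linear in `N`.
  obtain ⟨s, hs⟩ := exists_nat_ge (4 / (α - 1) + 1)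
  obtain ⟨n₀, hn₀, m, hinit⟩ := MCEuler.exists_measure_euler_initial_ge (hW 0) (hξ_meas 0) hμ hσ
    hnoise s
  set γ : ℝ := (α + 1) / 2 with hγ
  have hγ1 : 1 < γ := by linarith
  set q : ℝ := (√(2 * Real.pi))⁻¹ * Real.exp (-2) with hq
  have hq0 : 0 < q := by positivity
  have hq1 : q ≤ 1 := by
    refine mul_le_one₀ (inv_le_one_of_one_le₀ (Real.one_le_sqrt.2 ?_)) (Real.exp_pos _).le
      (Real.exp_le_one_iff.2 (by norm_num))
    linarith [Real.pi_gt_three]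
  refine tendsto_nhds_top_mono (ENNReal.tendsto_ofReal_atTop.comp tendsto_natCast_atTop_atTop) ?_
  filter_upwards [hinit, MCEuler.eventually_exp_pow_le (a := -Real.log q) (C := c + |e|) hγ1 hc
      (neg_nonneg.2 (Real.log_nonpos hq0.le hq1)) (by positivity) m, MCEuler.eventually_le_natCast T, MCEuler.eventually_le_natCast c,
    MCEuler.eventually_le_natCast (2 * c / T), MCEuler.eventually_le_natCast (Real.exp 1),
    eventually_ge_atTop 1] with N hP hV hNT hNc hNT' hNe hN1
  have hN1' : (1 : ℝ) ≤ N := by exact_mod_cast hN1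
  have hN0 : (0 : ℝ) < N := by linarith
  have hα' : 0 < α - 1 := by linarith
  have hs1 : s ≠ 0 := by
    rintro rfl
    have : 0 < 4 / (α - 1) := by positivity
    norm_num at hs
    linarith
  have hs2 : 2 ≤ s * ((α - 1) / 2) := by
    have h4 : 4 / (α - 1) ≤ s := by linarith
    rw [div_le_iff₀ hα'] at h4
    linarith
  have hNs : (N : ℝ) ≤ (N : ℝ) ^ s := le_self_pow₀ hN1' hs1
  have hK : 2 * c / (T / N) ≤ ((N : ℝ) ^ s) ^ ((α - 1) / 2) := by
    calc 2 * c / (T / N) = 2 * c / T * N := by field_simp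
      _ ≤ (N : ℝ) ^ (2 : ℝ) := by rw [Real.rpow_two, sq]; gcongr
      _ ≤ (N : ℝ) ^ (s * ((α - 1) / 2)) := Real.rpow_le_rpow_of_exponent_le hN1' hs2
      _ = _ := Real.rpow_natCast_mul hN0.le _ _
  have hexpl := MCEuler.measure_euler_explosion (hW 0) (hξ_meas 0) hμ hσ hα hc hgrowth hNT
    (hNc.trans hNs) hK n₀ (N - n₀) (by lia)
  rw [← hγ, ← hq, show n₀ + (N - n₀) = N by lia] at hexpl
  set A := {ω | ((N : ℝ) ^ s) ^ (γ ^ (N - n₀)) ≤ |MCEuler.euler hT μ σ (ξ 0) (W 0) N N ω|} with hA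
  have hAm : MeasurableSet A := by
    have hY := (MCEuler.measurable_euler (hW 0) (hξ_meas 0) hμ hσ N N).mono (𝓕.le _) le_rfl
    exact measurableSet_le measurable_const hY.abs
  -- The exponent `N - 1` covers both `n₀ = 0` and `n₀ = 1`, and the base is lowered from `N ^ s` to
  -- `exp 1`.
  set V : ℝ := Real.exp (γ ^ (N - 1) / c) / (c * (N : ℝ) ^ 2) - (c + |e|) with hVdef
  have hexp1 : 1 ≤ Real.exp ((N : ℝ) ^ m + -Real.log q * N) := by
    have := Real.log_nonpos hq0.le hq1
    refine Real.one_le_exp (add_nonneg (by positivity) (mul_nonneg (by linarith) hN0.le))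
  -- An error of at least 1 only grows under the power `p`, which reduces the bound to `p = 1`.
  have hV1 : 1 ≤ V := by nlinarith
  have hpA : ENNReal.ofReal (Real.exp (-((N : ℝ) ^ m + -Real.log q * N))) ≤ P A := by
    refine le_trans ?_ ((mul_le_mul_right hP _).trans hexpl)
    rw [← ENNReal.ofReal_pow hq0.le, ← ENNReal.ofReal_mul (by positivity)]
    refine ENNReal.ofReal_le_ofReal ?_
    have e1 : Real.exp (-((N : ℝ) ^ m + -Real.log q * N)) = q ^ N * Real.exp (-(N : ℝ) ^ m) := by
      rw [neg_add, Real.exp_add, mul_comm]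
      congr 1
      rw [neg_mul, neg_neg, mul_comm, Real.exp_nat_mul, Real.exp_log hq0]
    rw [e1]
    gcongr ?_ * _
    exact pow_le_pow_of_le_one hq0.le hq1 (Nat.sub_le _ _)
  have hval : ∀ ω ∈ A, V ≤ |e - 1 / (N : ℝ) ^ 2 *
      ∑ k ∈ Finset.range (N ^ 2), f (MCEuler.euler hT μ σ (ξ k) (W k) N N ω)| := by
    intro ω hω
    have havg := MCEuler.sub_le_average (g := fun x => 1 / c * |x| ^ (1 / c))
      (fun x => by positivity) hf_growth (M := N ^ 2) (by positivity)
      (fun k => MCEuler.euler hT μ σ (ξ k) (W k) N N ω)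
    push_cast at havg
    have h1 : Real.exp (γ ^ (N - 1) / c) ≤
        |MCEuler.euler hT μ σ (ξ 0) (W 0) N N ω| ^ (1 / c) := by
      calc Real.exp (γ ^ (N - 1) / c) = (Real.exp 1 ^ (γ ^ (N - 1))) ^ (1 / c) := by
            rw [Real.exp_one_rpow, ← Real.exp_mul, mul_one_div]
        _ ≤ (((N : ℝ) ^ s) ^ (γ ^ (N - n₀))) ^ (1 / c) := by
            refine Real.rpow_le_rpow (by positivity) ?_ (by positivity)
            refine (Real.rpow_le_rpow (Real.exp_pos 1).le (hNe.trans hNs) (by positivity)).trans ?_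
            refine Real.rpow_le_rpow_of_exponent_le (hN1'.trans hNs) ?_
            exact pow_le_pow_right₀ hγ1.le (by lia)
        _ ≤ _ := Real.rpow_le_rpow (by positivity) hω (by positivity)
    have h2 : Real.exp (γ ^ (N - 1) / c) / (c * (N : ℝ) ^ 2) ≤
        1 / c * |MCEuler.euler hT μ σ (ξ 0) (W 0) N N ω| ^ (1 / c) / (N : ℝ) ^ 2 := by
      rw [one_div_mul_eq_div, div_div]
      gcongr
    rw [abs_sub_comm]
    refine le_trans ?_ (le_abs_self _)
    linarith [le_abs_self e]
  calc ENNReal.ofReal N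
      ≤ ENNReal.ofReal V * ENNReal.ofReal (Real.exp (-((N : ℝ) ^ m + -Real.log q * N))) := by
        rw [← ENNReal.ofReal_mul (by linarith)]
        refine ENNReal.ofReal_le_ofReal ?_
        rw [Real.exp_neg, ← div_eq_mul_inv, le_div_iff₀ (Real.exp_pos _), mul_comm]
        exact hV
    _ ≤ ENNReal.ofReal V * P A := by gcongr
    _ = ∫⁻ _ in A, ENNReal.ofReal V ∂P := (setLIntegral_const _ _).symm
    _ ≤ ∫⁻ ω in A, ENNReal.ofReal |e - 1 / (N : ℝ) ^ 2 *
      ∑ k ∈ Finset.range (N ^ 2), f (MCEuler.euler hT μ σ (ξ k) (W k) N N ω)| ^ p ∂P := by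
        refine setLIntegral_mono' hAm fun ω hω => ?_
        have h1 := ENNReal.ofReal_le_ofReal (hval ω hω)
        have h2 : (1 : ℝ≥0∞) ≤ ENNReal.ofReal V := ENNReal.one_le_ofReal.2 hV1
        exact h1.trans (ENNReal.le_rpow_self_of_one_le (h2.trans h1) hp)
    _ ≤ _ := setLIntegral_le_lintegral _ _
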